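/- **Setting.** Let $r\ge 2$ and $c\ge 0$. For a random vector $X=(X_1,\dots,X_r)$ whose coordinates have distribution functions $F_1,\dots,F_r$, and for $S\subseteq\{1,\dots,r\}$ with $|S|\ge 2$, put $$\mathrm{RdCov}^2(X_S)=\int_{\mathbb R^S}\Big|\mathbb E\prod_{i\in S}\Big(\mathbb E\,e^{\iota t_iF_i(X_i)}-e^{\iota t_iF_i(X_i)}\Big)\Big|^2\prod_{i\in S}\frac{dt_i}{\pi t_i^2},\qquad \mathrm{RJdCov}^2(X;c)=\sum_{s=2}^r c^{\,r-s}\sum_{|S|=s}\mathrm{RdCov}^2(X_S)$$ (with $0^0=1$). For data $y_1,\dots,y_n\in\mathbb R^r$ with coordinatewise empirical distribution functions $\hat F_i(x)=\frac1n\#\{a: y_{a,i}\le x\}$, put $$\mathrm{RdCov}_n^2(y_S)=\int_{\mathbb R^S}\Big|\frac1n\sum_{b=1}^n\prod_{i\in S}\Big(\frac1n\sum_{a=1}^n e^{\iota t_i\hat F_i(y_{a,i})}-e^{\iota t_i\hat F_i(y_{b,i})}\Big)\Big|^2\prod_{i\in S}\frac{dt_i}{\pi t_i^2},\qquad \mathrm{RJdCov}_n^2(y;c)=\sum_{s=2}^r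 c^{\,r-s}\sum_{|S|=s}\mathrm{RdCov}_n^2(y_S).$$ For $\theta=(\theta_{i,j})_{1\le i<j\le r}$ let $W(\theta)=Q^{(r-1)}\cdots Q^{(1)}\in \mathcal{SO}(r)$ with $Q^{(i)}=Q_{i,r}(\theta_{i,r})\cdots Q_{i,i+1}(\theta_{i,i+1})$, where $Q_{i,j}(\alpha)$ is the identity matrix with the $(i,i)$ and $(j,j)$ entries replaced by $\cos\alpha$, the $(i,j)$ entry by $-\sin\alpha$ and the $(j,i)$ entry by $\sin\alpha$. Let $\Theta$ be the set of $\theta$ with $0\le\theta_{1,j}<2\pi$ and $0\le\theta_{i,j}<\pi$ for $i\ne 1$. A signed permutation matrix is a permutation matrix whose nonzero entries may be $\pm1$. **Theorem.** Let $Z$ be a random vector in $\mathbb R^r$ with $\mathbb E Z=0$, $\operatorname{Var} Z=I_r$ and a uniformly bounded Lebesgue density, and let $Z_1,Z_2,\dots$ be i.i.d. copies of $Z$. Let $\bar\Theta\subseteq\Theta$ be a compact set on which $\theta\mapsto W(\theta)$ has a continuous inverse (that is, there is a continuous map $g$ on $W(\bar\Theta)$ with $g(W(\theta))=\theta$ for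 $\theta\in\bar\Theta$). Suppose that $\theta_0\in\bar\Theta$ minimizes $\theta\mapsto\mathrm{RJdCov}^2(W(\theta)Z;c)$ over $\bar\Theta$ and is the unique minimizer up to signed permutations: for every other minimizer $\theta\in\bar\Theta$ there is a signed permutation matrix $P_\pm$ with $W(\theta)=P_\pm W(\theta_0)$ (for instance, $\theta_0$ is the only minimizer in $\bar\Theta$). Let $\hat\theta_n\in\bar\Theta$ be any minimizer over $\bar\Theta$ of $\theta\mapsto \mathrm{RJdCov}_n^2\big((W(\theta)Z_a)_{1\le a\le n};c\big)$. Then $\hat\theta_n$ is consistent for $\theta_0$ over $\mathcal{SO}(r)$: the map $\theta\mapsto W(\theta)$ is continuous, and $$\mathcal D\big(W(\hat\theta_n),W(\theta_0)\big)\to 0\quad\text{almost surely as } n\to\infty$$ for every $\mathcal D:\mathcal{SO}(r)\times \mathcal{SO}(r)\to[0,\infty)$ that is symmetric, satisfies the triangle inequality, is continuous for the usual topology of $\mathcal{SO}(r)$, and satisfies $\mathcal D(W,A)=0$ if and only if $W=P_\pm A$ for some signed permutation matrix $P_\pm$. -/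

import Mathlib

open MeasureTheory ProbabilityTheory Filter Topology Matrix

namespace RankICA

noncomputable section

/-! ### Rank joint distance covariance, population version -/

/-- The density `w₁(t) = 1 / (π t²)` with respect to Lebesgue measure on `ℝ`
(the constant is `c₁ = π ^ ((1+1)/2) / Γ((1+1)/2) = π`). -/
def weight (t : ℝ) : ℝ := 1 / (Real.pi * t ^ 2)

/-- The one-dimensional population rank map of a real random variable `Y`,
that is, its distribution function `x ↦ P(Y ≤ x)`. -/
def rankMap {Ω : Type*} [MeasurableSpace Ω] (P : Measure Ω) (Y : Ω → ℝ) (x : ℝ) : ℝ :=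
  P.real {ω | Y ω ≤ x}

/-- The squared rank distance covariance `RdCov²(X_S)` of the subfamily `(X_i)_{i ∈ S}`:
the integral over `t ∈ ℝ^S`, against `∏_{i ∈ S} dt_i / (π t_i²)`, of
`|E ∏_{i ∈ S} (E e^{𝐢 t_i R_i(X_i)} - e^{𝐢 t_i R_i(X_i)})|²`,
with `R_i` the population rank map of `X_i`. -/
def rdCovSq {Ω : Type*} [MeasurableSpace Ω] (P : Measure Ω) {r : ℕ} (X : Ω → Fin r → ℝ)
    (S : Finset (Fin r)) : ℝ :=
  ∫ t : S → ℝ,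
    ‖∫ ω, ∏ i : S,
        ((∫ ω', Complex.exp
            (Complex.I * ((t i * rankMap P (fun ξ => X ξ i) (X ω' i) : ℝ) : ℂ)) ∂P) -
          Complex.exp
            (Complex.I * ((t i * rankMap P (fun ξ => X ξ i) (X ω i) : ℝ) : ℂ))) ∂P‖ ^ 2 *
      ∏ i : S, weight (t i)

/-- The squared rank joint distance covariance
`RJdCov²(X; c) = ∑_{s=2}^r c^{r-s} ∑_{|S| = s} RdCov²(X_S)`. -/
def rjdCovSq {Ω : Type*} [MeasurableSpace Ω] (P : Measure Ω) {r : ℕ} (c : ℝ)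
    (X : Ω → Fin r → ℝ) : ℝ :=
  ∑ s ∈ Finset.Icc 2 r,
    c ^ (r - s) * ∑ S ∈ Finset.powersetCard s (Finset.univ : Finset (Fin r)), rdCovSq P X S

/-! ### Rank joint distance covariance, sample version -/

/-- The one-dimensional empirical rank map of the `i`-th coordinate of the data `y_1, …, y_n`,
that is, its empirical distribution function `x ↦ n⁻¹ #{a : y_{a,i} ≤ x}`. -/
def empRankMap {n r : ℕ} (y : Fin n → Fin r → ℝ) (i : Fin r) (x : ℝ) : ℝ :=
  (n : ℝ)⁻¹ * ((Finset.univ.filter fun a : Fin n => y a i ≤ x).card : ℝ)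

/-- The squared empirical rank distance covariance `RdCov_n²` of the coordinates in `S`. -/
def empRdCovSq {n r : ℕ} (y : Fin n → Fin r → ℝ) (S : Finset (Fin r)) : ℝ :=
  ∫ t : S → ℝ,
    ‖(n : ℂ)⁻¹ * ∑ b : Fin n, ∏ i : S,
        ((n : ℂ)⁻¹ * (∑ a : Fin n,
            Complex.exp (Complex.I * ((t i * empRankMap y i (y a i) : ℝ) : ℂ))) -
          Complex.exp (Complex.I * ((t i * empRankMap y i (y b i) : ℝ) : ℂ)))‖ ^ 2 *
      ∏ i : S, weight (t i)

/-- The squared empirical rank joint distance covariance `RJdCov_n²(y; c)` of data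
`y_1, …, y_n ∈ ℝ^r`. -/
def empRjdCovSq {n r : ℕ} (c : ℝ) (y : Fin n → Fin r → ℝ) : ℝ :=
  ∑ s ∈ Finset.Icc 2 r,
    c ^ (r - s) * ∑ S ∈ Finset.powersetCard s (Finset.univ : Finset (Fin r)), empRdCovSq y S

/-! ### The rotation group and its parametrization by angles -/

/-- The rotation group `SO(r)`, with the topology inherited from the space of matrices. -/
abbrev SO (r : ℕ) : Type := Matrix.specialOrthogonalGroup (Fin r) ℝ

/-- Triangular arrays of angles `θ_{i,j}`, `i < j`; the indices start at `0`. -/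
abbrev Angles (r : ℕ) : Type := {p : Fin r × Fin r // p.1 < p.2} → ℝ

/-- The matrix `Q_{i,j}(α)`: the identity matrix with the `(i,i)` and `(j,j)` entries replaced by
`cos α`, the `(i,j)` entry by `-sin α` and the `(j,i)` entry by `sin α`. -/
def givensMatrix {r : ℕ} (i j : Fin r) (α : ℝ) : Matrix (Fin r) (Fin r) ℝ :=
  Matrix.of fun a b =>
    if a = i ∧ b = i then Real.cos α
    else if a = j ∧ b = j then Real.cos α
    else if a = i ∧ b = j then -Real.sin α
    else if a = j ∧ b = i then Real.sin α
    else if a = b then 1 else 0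

theorem givensMatrix_mul {r : ℕ} {i j : Fin r} (h : i ≠ j) (α β : ℝ) :
    givensMatrix i j α * givensMatrix i j β = givensMatrix i j (α + β) := by
  ext a b
  have key : ∀ k, givensMatrix i j α a k =
      (if k = i then (if a = i then Real.cos α else if a = j then Real.sin α else 0) else 0) +
      (if k = j then (if a = i then -Real.sin α else if a = j then Real.cos α else 0) else 0) +
      (if k = a then (if a = i then 0 else if a = j then 0 else 1) else 0) := by
    intro k
    simp only [givensMatrix, Matrix.of_apply]
    grind
  rw [Matrix.mul_apply]
  simp only [key, add_mul, ite_mul, zero_mul, Finset.sum_add_distrib, Finset.sum_ite_eq',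
    Finset.mem_univ, if_true]
  simp only [givensMatrix, Matrix.of_apply, Real.cos_add, Real.sin_add]
  grind

theorem givensMatrix_zero {r : ℕ} {i j : Fin r} :
    givensMatrix i j 0 = 1 := by
  ext a b
  simp only [givensMatrix, Matrix.of_apply, Matrix.one_apply, Real.cos_zero, Real.sin_zero]
  grind

theorem givensMatrix_transpose {r : ℕ} {i j : Fin r} (h : i ≠ j) (α : ℝ) :
    (givensMatrix i j α)ᵀ = givensMatrix i j (-α) := by
  ext a b
  simp only [givensMatrix, Matrix.of_apply, Matrix.transpose_apply, Real.cos_neg, Real.sin_neg]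
  grind

theorem givensMatrix_mem {r : ℕ} {i j : Fin r} (h : i ≠ j) (α : ℝ) :
    givensMatrix i j α ∈ Matrix.specialOrthogonalGroup (Fin r) ℝ := by
  have horth : ∀ β, givensMatrix i j β * (givensMatrix i j β)ᵀ = 1 := by
    intro β
    rw [givensMatrix_transpose h, givensMatrix_mul h, add_neg_cancel, givensMatrix_zero]
  rw [Matrix.mem_specialOrthogonalGroup_iff, Matrix.mem_orthogonalGroup_iff]
  refine ⟨horth α, ?_⟩
  have hsq := congrArg Matrix.det (horth (α / 2))
  rw [Matrix.det_mul, Matrix.det_transpose, Matrix.det_one, ← Matrix.det_mul,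
    givensMatrix_mul h, add_halves] at hsq
  exact hsq

/-- `Q_{i,j}(α)` as an element of `SO(r)`, for `i < j`. -/
def givens {r : ℕ} (i j : Fin r) (h : i < j) (α : ℝ) : SO r :=
  ⟨givensMatrix i j α, givensMatrix_mem h.ne α⟩

/-- `Q^{(i)} = Q_{i,r}(θ_{i,r}) ⋯ Q_{i,i+1}(θ_{i,i+1})`. -/
def rowRotation {r : ℕ} (θ : Angles r) (i : Fin r) : SO r :=
  ((List.finRange r).reverse.map fun j =>
    if h : i < j then givens i j h (θ ⟨(i, j), h⟩) else 1).prod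

/-- `W(θ) = Q^{(r-1)} ⋯ Q^{(1)}` (the factor for the last index is an empty product). -/
def rotation {r : ℕ} (θ : Angles r) : SO r :=
  ((List.finRange r).reverse.map fun i => rowRotation θ i).prod

/-- The parameter set `Θ`: the angles of the first row lie in `[0, 2π)`, all others in `[0, π)`. -/
def angleSet (r : ℕ) : Set (Angles r) :=
  {θ | ∀ p : {p : Fin r × Fin r // p.1 < p.2},
    0 ≤ θ p ∧ (p.1.1.val = 0 → θ p < 2 * Real.pi) ∧ (p.1.1.val ≠ 0 → θ p < Real.pi)}

/-- The random vector `W(θ) z` for `z ∈ ℝ^r`. -/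
def rotate {r : ℕ} (θ : Angles r) (z : Fin r → ℝ) : Fin r → ℝ :=
  (rotation θ : Matrix (Fin r) (Fin r) ℝ) *ᵥ z

/-! ### Consistency up to signed permutations -/

/-- Signed permutation matrices. -/
def IsSignedPerm {r : ℕ} (Q : Matrix (Fin r) (Fin r) ℝ) : Prop :=
  ∃ (σ : Equiv.Perm (Fin r)) (ε : Fin r → ℝ), (∀ i, ε i = 1 ∨ ε i = -1) ∧
    Q = Matrix.diagonal ε * σ.permMatrix ℝ

/-- `W = P_± A` for some signed permutation matrix `P_±`. -/
def SignedPermEquiv {r : ℕ} (W A : SO r) : Prop :=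
  ∃ Q : Matrix (Fin r) (Fin r) ℝ, IsSignedPerm Q ∧
    (W : Matrix (Fin r) (Fin r) ℝ) = Q * (A : Matrix (Fin r) (Fin r) ℝ)

/-- `D` is a (continuous) metric on `SO(r)` modulo signed permutations: it is symmetric, satisfies
the triangle inequality, is continuous for the usual topology of `SO(r)`, and vanishes exactly on
the pairs that differ by a signed permutation matrix. -/
structure IsSignedPermMetric {r : ℕ} (D : SO r → SO r → ℝ) : Prop where
  nonneg : ∀ W A, 0 ≤ D W A
  symm : ∀ W A, D W A = D A W
  triangle : ∀ W A B, D W B ≤ D W A + D A B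
  eq_zero_iff : ∀ W A, D W A = 0 ↔ SignedPermEquiv W A
  continuous : Continuous fun p : SO r × SO r => D p.1 p.2

/-- The sequence of estimators `θ̂_n` is consistent for `θ₀` over `SO(r)`: the map `θ ↦ W(θ)` is
continuous, and `D(W(θ̂_n), W(θ₀)) → 0` almost surely for every metric `D` as above. -/
def IsConsistentOverSO {Ω : Type*} [MeasurableSpace Ω] (P : Measure Ω) {r : ℕ}
    (θhat : ℕ → Ω → Angles r) (θ₀ : Angles r) : Prop :=
  Continuous (rotation : Angles r → SO r) ∧
    ∀ D : SO r → SO r → ℝ, IsSignedPermMetric D →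
      ∀ᵐ ω ∂P, Tendsto (fun n => D (rotation (θhat n ω)) (rotation θ₀)) atTop (𝓝 0)

end

end RankICA

/-! Both objectives are one functional of a law: `rjdCovSq` depends only on the law of its vector,
and the empirical objective is its value at the empirical measure (`rdCovSq_map`, `empRjdCovSq_eq`).
Consistency is therefore a compactness argument for minimizers of `lawRjdCovSq c (rotateLaw θ ν)`,
resting on three continuity facts.

The functional is weakly continuous at every law whose coordinates have no atoms
(`tendsto_rdCovSq`): Pólya's theorem makes the rank maps converge uniformly, hence the inner
expectations converge for each `t`, and dominated convergence handles the singular weight. The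
rotated law is jointly continuous in angle and law (`tendsto_rotateLaw`), and it has atomless
coordinates because rotations preserve Lebesgue null sets (`rotateLaw_hyperplane`). Empirical
measures converge weakly almost surely (`ae_tendsto_empiricalMeasure`).

Hence every cluster point of the estimators minimizes the population objective, so it is at
`D`-distance zero from `θ₀`. -/

namespace RankICA

noncomputable section

/-! ### Uniform convergence of distribution functions -/

/-- **Pólya's theorem**: pointwise convergence of monotone functions with values in `[0, 1]` to a
continuous distribution function is uniform. -/
theorem tendstoUniformly_of_monotone {ι : Type*} {l : Filter ι} {F : ι → ℝ → ℝ} {G : ℝ → ℝ}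
    (hF : ∀ n, Monotone (F n)) (hF0 : ∀ n x, 0 ≤ F n x) (hF1 : ∀ n x, F n x ≤ 1)
    (hG : Continuous G) (hGm : Monotone G)
    (hbot : Tendsto G atBot (𝓝 0)) (htop : Tendsto G atTop (𝓝 1))
    (h : ∀ x, Tendsto (fun n => F n x) l (𝓝 (G x))) :
    TendstoUniformly F G l := by
  have hG0 : ∀ x, 0 ≤ G x := fun x => hGm.le_of_tendsto hbot x
  have hG1 : ∀ x, G x ≤ 1 := fun x => hGm.ge_of_tendsto htop x
  rw [Metric.tendstoUniformly_iff]
  intro ε hε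
  obtain ⟨K, hK⟩ := exists_nat_gt (2 / ε)
  have hKpos : (0 : ℝ) < K := lt_trans (by positivity) hK
  have hKε : 1 / (K : ℝ) < ε / 2 := by
    rw [div_lt_iff₀ hKpos]
    rw [div_lt_iff₀ hε] at hK
    linarith
  -- A grid of quantiles of `G` at the levels `k / K`, `0 < k < K`. Controlling `F n` at these
  -- finitely many points suffices, since monotonicity loses at most `1 / K < ε / 2` in between.
  have hy : ∀ k : ℕ, ∃ y, 0 < k → k < K → G y = k / K := by
    intro k
    by_cases hk : 0 < k ∧ k < K
    · have h1 : (k : ℝ) / K < 1 := by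
        rw [div_lt_one hKpos]
        exact_mod_cast hk.2
      have h0 : 0 < (k : ℝ) / K := div_pos (by exact_mod_cast hk.1) hKpos
      obtain ⟨a, ha⟩ := (hbot.eventually (gt_mem_nhds h0)).exists
      obtain ⟨b, hb⟩ := (htop.eventually (lt_mem_nhds h1)).exists
      obtain ⟨y, hy⟩ := mem_range_of_exists_le_of_exists_ge hG ⟨a, ha.le⟩ ⟨b, hb.le⟩
      exact ⟨y, fun _ _ => hy⟩
    · exact ⟨0, fun h0 h1 => absurd ⟨h0, h1⟩ hk⟩
  choose y hy using hy
  have hev : ∀ᶠ n in l, ∀ k ∈ Finset.range K, |F n (y k) - G (y k)| < ε / 2 := by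
    rw [Finset.eventually_all]
    intro k _
    have := (Metric.tendsto_nhds.1 (h (y k))) (ε / 2) (by positivity)
    simpa [Real.dist_eq] using this
  filter_upwards [hev] with n hn x
  rw [Real.dist_eq, abs_sub_lt_iff]
  constructor
  · by_cases hx : G x ≤ 1 / K
    · linarith [hF0 n x]
    · push Not at hx
      have hx' : 1 < G x * K := by rwa [div_lt_iff₀ hKpos] at hx
      -- The largest grid level strictly below `G x`: `k / K < G x ≤ (k + 1) / K`.
      obtain ⟨k, hk⟩ : ∃ k : ℕ, ⌈G x * K⌉₊ = k + 1 :=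
        Nat.exists_eq_succ_of_ne_zero (Nat.ceil_pos.2 (by linarith)).ne'
      have hlt : (k : ℝ) < G x * K := by
        rw [← Nat.lt_ceil]; omega
      have hle : G x * K ≤ k + 1 := by
        have := Nat.le_ceil (G x * K)
        rw [hk] at this
        exact_mod_cast this
      have hk0 : 0 < k := by
        by_contra hk0
        have : k = 0 := by omega
        subst this
        simp at hle
        linarith
      have hkK : k < K := by
        have : (k : ℝ) < K := hlt.trans_le (by nlinarith [hG1 x])
        exact_mod_cast this
      have hGy := hy k hk0 hkK
      have hyx : y k ≤ x := by
        by_contra hc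
        have := hGm (le_of_not_ge hc)
        rw [hGy, le_div_iff₀ hKpos] at this
        linarith
      have h1 := hn k (Finset.mem_range.2 hkK)
      rw [abs_sub_lt_iff, hGy] at h1
      have h2 := hF n hyx
      have h3 : G x ≤ k / K + 1 / K := by
        rw [← add_div, le_div_iff₀ hKpos]; exact hle
      linarith [h1.2]
  · by_cases hx : 1 - 1 / K ≤ G x
    · linarith [hF1 n x]
    · push Not at hx
      have hx' : G x * K < K - 1 := by
        have := mul_lt_mul_of_pos_right hx hKpos
        rwa [sub_mul, one_mul, one_div_mul_cancel hKpos.ne'] at this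
      -- The smallest grid level strictly above `G x`; the case hypothesis keeps it below `K`.
      set k := ⌊G x * K⌋₊ + 1 with hk
      have hlt : G x * K < k := by
        rw [hk]; push_cast; exact Nat.lt_floor_add_one _
      have hle : (k : ℝ) ≤ G x * K + 1 := by
        rw [hk]; push_cast
        linarith [Nat.floor_le (mul_nonneg (hG0 x) hKpos.le)]
      have hkK : k < K := by
        have : (k : ℝ) < K := by linarith
        exact_mod_cast this
      have hGy := hy k (by omega) hkK
      have hyx : x ≤ y k := by
        by_contra hc
        have := hGm (le_of_not_ge hc)
        rw [hGy, div_le_iff₀ hKpos] at this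
        linarith
      have h1 := hn k (Finset.mem_range.2 hkK)
      rw [abs_sub_lt_iff, hGy] at h1
      have h2 := hF n hyx
      have h3 : k / K ≤ G x + 1 / K := by
        rw [div_le_iff₀ hKpos, add_mul, one_div_mul_cancel hKpos.ne']; exact hle
      linarith [h1.1]

section RankMap

variable {Ω : Type*} [MeasurableSpace Ω] {P : Measure Ω} {Y : Ω → ℝ}

theorem rankMap_nonneg (P : Measure Ω) (Y : Ω → ℝ) (x : ℝ) : 0 ≤ rankMap P Y x :=
  measureReal_nonneg

theorem rankMap_le_one (P : Measure Ω) [IsProbabilityMeasure P] (Y : Ω → ℝ) (x : ℝ) :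
    rankMap P Y x ≤ 1 :=
  measureReal_le_one

theorem rankMap_mono (P : Measure Ω) [IsFiniteMeasure P] (Y : Ω → ℝ) : Monotone (rankMap P Y) :=
  fun _ _ hab => measureReal_mono fun _ hω => le_trans hω hab

theorem measurable_rankMap (P : Measure Ω) [IsFiniteMeasure P] (Y : Ω → ℝ) :
    Measurable (rankMap P Y) :=
  (rankMap_mono P Y).measurable

theorem rankMap_eq_cdf [IsProbabilityMeasure P] (hY : Measurable Y) :
    rankMap P Y = cdf (P.map Y) := by
  have := Measure.isProbabilityMeasure_map (μ := P) hY.aemeasurable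
  ext x
  rw [cdf_eq_real, map_measureReal_apply hY measurableSet_Iic]
  rfl

theorem tendsto_rankMap_atBot [IsProbabilityMeasure P] (hY : Measurable Y) :
    Tendsto (rankMap P Y) atBot (𝓝 0) := by
  rw [rankMap_eq_cdf hY]
  exact tendsto_cdf_atBot _

theorem tendsto_rankMap_atTop [IsProbabilityMeasure P] (hY : Measurable Y) :
    Tendsto (rankMap P Y) atTop (𝓝 1) := by
  rw [rankMap_eq_cdf hY]
  exact tendsto_cdf_atTop _

/-- A distribution function is right-continuous and its jump at `x` is the mass of `{x}`, which is
zero. -/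
theorem continuous_rankMap [IsProbabilityMeasure P] (hY : Measurable Y)
    (h0 : ∀ x, P {ω | Y ω = x} = 0) : Continuous (rankMap P Y) := by
  have := Measure.isProbabilityMeasure_map (μ := P) hY.aemeasurable
  rw [rankMap_eq_cdf hY, continuous_iff_continuousAt]
  intro x
  rw [(monotone_cdf _).continuousAt_iff_leftLim_eq_rightLim, StieltjesFunction.rightLim_eq]
  have h := (cdf (P.map Y)).measure_singleton x
  rw [measure_cdf, Measure.map_apply hY (measurableSet_singleton x),
    show Y ⁻¹' {x} = {ω | Y ω = x} from rfl, h0, eq_comm, ENNReal.ofReal_eq_zero] at h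
  exact le_antisymm ((monotone_cdf _).leftLim_le le_rfl) (by linarith)

end RankMap

/-! ### The integrand of the rank distance covariance -/

theorem norm_exp_I_mul (x : ℝ) : ‖Complex.exp (Complex.I * (x : ℂ))‖ = 1 := by
  rw [mul_comm]; exact Complex.norm_exp_ofReal_mul_I x

theorem norm_exp_I_mul_sub_le (x y : ℝ) :
    ‖Complex.exp (Complex.I * (x : ℂ)) - Complex.exp (Complex.I * (y : ℂ))‖ ≤ |x - y| := by
  have h : Complex.exp (Complex.I * (x : ℂ)) - Complex.exp (Complex.I * (y : ℂ)) =
      Complex.exp (Complex.I * (y : ℂ)) * (Complex.exp (Complex.I * ((x - y : ℝ) : ℂ)) - 1) := by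
    rw [mul_sub, ← Complex.exp_add]
    push_cast
    ring_nf
  rw [h, norm_mul, norm_exp_I_mul, one_mul]
  exact Real.norm_exp_I_mul_ofReal_sub_one_le

theorem weight_nonneg (t : ℝ) : 0 ≤ weight t := by
  unfold weight; positivity

theorem measurable_weight : Measurable weight := by
  unfold weight; fun_prop

/-- The one-dimensional dominating function: the factor `t ^ 2` cancels the singularity at `0`, and
boundedness gives decay at infinity. The constant `5` comes from `m ≤ t ^ 2` and `m ≤ 4`, which give
`m * (1 + t ^ 2) ≤ 5 * t ^ 2` for `m = (min 2 |t|) ^ 2`. -/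
theorem integrable_min_sq_mul_weight :
    Integrable fun t : ℝ => (min 2 |t|) ^ 2 * weight t := by
  refine (integrable_inv_one_add_sq.const_mul (5 / Real.pi)).mono'
    ((by fun_prop : Measurable fun t : ℝ => (min 2 |t|) ^ 2).mul
      measurable_weight).aestronglyMeasurable (Eventually.of_forall fun t => ?_)
  have hpi := Real.pi_pos
  rw [Real.norm_of_nonneg (mul_nonneg (sq_nonneg _) (weight_nonneg t))]
  by_cases ht : t = 0
  · subst ht
    simp [weight]
    positivity
  have ht2 : 0 < t ^ 2 := by positivity
  have hrw : (min 2 |t|) ^ 2 * weight t = (min 2 |t|) ^ 2 / t ^ 2 / Real.pi := by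
    unfold weight; field_simp
  rw [hrw, show 5 / Real.pi * (1 + t ^ 2)⁻¹ = 5 / (1 + t ^ 2) / Real.pi by field_simp]
  gcongr 1
  have hm0 : 0 ≤ min 2 |t| := le_min (by norm_num) (abs_nonneg t)
  have h1 : (min 2 |t|) ^ 2 ≤ 4 := by nlinarith [min_le_left 2 |t|]
  have h2 : (min 2 |t|) ^ 2 ≤ t ^ 2 := by
    rw [← sq_abs t]
    exact pow_le_pow_left₀ hm0 (min_le_right _ _) 2
  rw [div_le_div_iff₀ ht2 (by positivity)]
  nlinarith

section Integrand

variable {Ω : Type*} [MeasurableSpace Ω]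

/-- The centred characteristic factor `E e^{𝐢 s R(Y)} - e^{𝐢 s R(Y)}`, with `R` the rank map
of `Y`. -/
def rankFactor (P : Measure Ω) (Y : Ω → ℝ) (s : ℝ) (ω : Ω) : ℂ :=
  (∫ ω', Complex.exp (Complex.I * ((s * rankMap P Y (Y ω') : ℝ) : ℂ)) ∂P) -
    Complex.exp (Complex.I * ((s * rankMap P Y (Y ω) : ℝ) : ℂ))

theorem rdCovSq_eq (P : Measure Ω) {r : ℕ} (X : Ω → Fin r → ℝ) (S : Finset (Fin r)) :
    rdCovSq P X S = ∫ t : S → ℝ,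
      ‖∫ ω, ∏ i : S, rankFactor P (fun ξ => X ξ i) (t i) ω ∂P‖ ^ 2 * ∏ i : S, weight (t i) :=
  rfl

variable {P : Measure Ω} [IsProbabilityMeasure P] {Y : Ω → ℝ}

theorem measurable_exp_rankMap (hY : Measurable Y) :
    Measurable fun p : ℝ × Ω =>
      Complex.exp (Complex.I * ((p.1 * rankMap P Y (Y p.2) : ℝ) : ℂ)) := by
  have h : Measurable fun p : ℝ × Ω => rankMap P Y (Y p.2) :=
    (measurable_rankMap P Y).comp (hY.comp measurable_snd)
  fun_prop

theorem integrable_exp_rankMap (hY : Measurable Y) (s : ℝ) :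
    Integrable (fun ω => Complex.exp (Complex.I * ((s * rankMap P Y (Y ω) : ℝ) : ℂ))) P :=
  Integrable.of_bound
    ((measurable_exp_rankMap hY).comp measurable_prodMk_left).aestronglyMeasurable 1
    (Eventually.of_forall fun _ => (norm_exp_I_mul _).le)

theorem measurable_rankFactor (hY : Measurable Y) :
    Measurable fun p : ℝ × Ω => rankFactor P Y p.1 p.2 := by
  have h := (measurable_exp_rankMap (P := P) hY)
  have h' : Measurable fun s : ℝ =>
      ∫ ω', Complex.exp (Complex.I * ((s * rankMap P Y (Y ω') : ℝ) : ℂ)) ∂P :=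
    (h.stronglyMeasurable.integral_prod_right' (ν := P)).measurable
  exact (h'.comp measurable_fst).sub h

/-- The bound `2` is the triangle inequality. For `|s|`, the factor is an average of differences of
exponentials whose phases differ by at most `|s|`, ranks lying in `[0, 1]`. -/
theorem norm_rankFactor_le (hY : Measurable Y) (s : ℝ) (ω : Ω) :
    ‖rankFactor P Y s ω‖ ≤ min 2 |s| := by
  refine le_min ?_ ?_
  · refine (norm_sub_le _ _).trans ?_
    have h1 := norm_integral_le_of_norm_le_const (μ := P) (C := 1)
      (f := fun ω' => Complex.exp (Complex.I * ((s * rankMap P Y (Y ω') : ℝ) : ℂ)))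
      (Eventually.of_forall fun _ => (norm_exp_I_mul _).le)
    rw [norm_exp_I_mul]
    simp only [probReal_univ, mul_one] at h1
    linarith
  · have h : rankFactor P Y s ω =
        ∫ ω', (Complex.exp (Complex.I * ((s * rankMap P Y (Y ω') : ℝ) : ℂ)) -
          Complex.exp (Complex.I * ((s * rankMap P Y (Y ω) : ℝ) : ℂ))) ∂P := by
      rw [integral_sub (integrable_exp_rankMap hY s) (integrable_const _)]
      simp [rankFactor]
    rw [h]
    have h1 := norm_integral_le_of_norm_le_const (μ := P) (C := |s|)
      (f := fun ω' => Complex.exp (Complex.I * ((s * rankMap P Y (Y ω') : ℝ) : ℂ)) -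
          Complex.exp (Complex.I * ((s * rankMap P Y (Y ω) : ℝ) : ℂ)))
      (Eventually.of_forall fun ω' => by
        refine (norm_exp_I_mul_sub_le _ _).trans ?_
        rw [← mul_sub, abs_mul]
        refine mul_le_of_le_one_right (abs_nonneg _) (abs_sub_le_iff.2 ⟨?_, ?_⟩) <;>
        linarith [rankMap_nonneg P Y (Y ω), rankMap_nonneg P Y (Y ω'), rankMap_le_one P Y (Y ω),
          rankMap_le_one P Y (Y ω')])
    simpa using h1

variable {r : ℕ} {X : Ω → Fin r → ℝ}

theorem measurable_prod_rankFactor (hX : Measurable X) (S : Finset (Fin r)) :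
    Measurable fun p : (S → ℝ) × Ω => ∏ i : S, rankFactor P (fun ξ => X ξ i) (p.1 i) p.2 := by
  refine Finset.measurable_fun_prod _ fun i _ => ?_
  have h : Measurable fun p : (S → ℝ) × Ω => (p.1 i, p.2) := by fun_prop
  exact (measurable_rankFactor (P := P) ((measurable_pi_apply i.1).comp hX)).comp h

theorem measurable_prod_rankFactor_apply (hX : Measurable X) (S : Finset (Fin r)) (t : S → ℝ) :
    Measurable fun ω => ∏ i : S, rankFactor P (fun ξ => X ξ i) (t i) ω :=
  Finset.measurable_fun_prod _ fun i _ =>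
    (measurable_rankFactor ((measurable_pi_apply i.1).comp hX)).of_uncurry_left (x := t i)

theorem norm_integral_prod_rankFactor_le (hX : Measurable X) (S : Finset (Fin r)) (t : S → ℝ) :
    ‖∫ ω, ∏ i : S, rankFactor P (fun ξ => X ξ i) (t i) ω ∂P‖ ≤ ∏ i : S, min 2 |t i| := by
  have h := norm_integral_le_of_norm_le_const (μ := P)
    (f := fun ω => ∏ i : S, rankFactor P (fun ξ => X ξ i) (t i) ω) (C := ∏ i : S, min 2 |t i|)
    (Eventually.of_forall fun ω => by
      rw [norm_prod]
      exact Finset.prod_le_prod (fun _ _ => norm_nonneg _) fun i _ =>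
        norm_rankFactor_le ((measurable_pi_apply i.1).comp hX) _ _)
  simpa using h

/-- The rank distance covariance depends only on the law of the vector. -/
theorem rdCovSq_map (hX : Measurable X) (S : Finset (Fin r)) :
    rdCovSq (P.map X) (fun z => z) S = rdCovSq P X S := by
  have := Measure.isProbabilityMeasure_map (μ := P) hX.aemeasurable
  have hrank : ∀ i : Fin r, rankMap (P.map X) (fun z => z i) = rankMap P (fun ω => X ω i) := by
    intro i
    ext x
    exact map_measureReal_apply hX (measurableSet_le (measurable_pi_apply i) measurable_const)
  have hfac : ∀ (i : Fin r) (s : ℝ) (ω : Ω),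
      rankFactor (P.map X) (fun z => z i) s (X ω) = rankFactor P (fun ω => X ω i) s ω := by
    intro i s ω
    unfold rankFactor
    rw [integral_map hX.aemeasurable
      (integrable_exp_rankMap (measurable_pi_apply i) s).aestronglyMeasurable]
    simp only [hrank]
  simp only [rdCovSq_eq]
  congr 1
  ext t
  have hm := measurable_prod_rankFactor_apply (P := P.map X) (X := fun z => z) measurable_id' S t
  rw [integral_map hX.aemeasurable hm.aestronglyMeasurable]
  simp only [hfac]

end Integrand

/-! ### Weak continuity of the rank distance covariance -/

/-- Weak convergence only tests a fixed continuous integrand, whereas here the integrand moves with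
`n` and may be discontinuous, as empirical ranks are. Uniform convergence allows replacing `h n` by
`h'`, because every `ν n` has mass one. -/
theorem tendsto_integral_of_tendstoUniformly {E : Type*} [TopologicalSpace E] [MeasurableSpace E]
    [OpensMeasurableSpace E] {ν : ℕ → ProbabilityMeasure E} {ν' : ProbabilityMeasure E}
    (hν : Tendsto ν atTop (𝓝 ν')) {h : ℕ → E → ℂ} {h' : E → ℂ} (hc : Continuous h') {C : ℝ}
    (hb' : ∀ x, ‖h' x‖ ≤ C) (hint : ∀ n, Integrable (h n) (ν n : Measure E))
    (hunif : TendstoUniformly h h' atTop) :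
    Tendsto (fun n => ∫ x, h n x ∂(ν n : Measure E)) atTop (𝓝 (∫ x, h' x ∂(ν' : Measure E))) := by
  let b : BoundedContinuousFunction E ℂ := BoundedContinuousFunction.ofNormedAddCommGroup h' hc C hb'
  have h1 : Tendsto (fun n => ∫ x, b x ∂(ν n : Measure E)) atTop
      (𝓝 (∫ x, b x ∂(ν' : Measure E))) :=
    (ProbabilityMeasure.tendsto_iff_forall_integral_rclike_tendsto ℂ).1 hν b
  refine (tendsto_iff_of_dist (Metric.tendsto_atTop.2 fun ε hε => ?_)).2 h1
  obtain ⟨N, hN⟩ := eventually_atTop.1 (Metric.tendstoUniformly_iff.1 hunif (ε / 2) (by positivity))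
  refine ⟨N, fun n hn => ?_⟩
  rw [Real.dist_0_eq_abs, abs_of_nonneg dist_nonneg, dist_eq_norm,
    ← integral_sub (hint n) (b.integrable _)]
  have h2 := norm_integral_le_of_norm_le_const (μ := (ν n : Measure E)) (C := ε / 2)
    (f := fun x => h n x - b x)
    (Eventually.of_forall fun x => by
      rw [norm_sub_rev, ← dist_eq_norm]
      exact (hN n hn x).le)
  simp only [probReal_univ, mul_one] at h2
  linarith

variable {r : ℕ} {ν : ℕ → ProbabilityMeasure (Fin r → ℝ)} {ν' : ProbabilityMeasure (Fin r → ℝ)}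

theorem tendstoUniformly_rankMap (hν : Tendsto ν atTop (𝓝 ν')) (i : Fin r)
    (h0 : ∀ x, (ν' : Measure (Fin r → ℝ)) {z | z i = x} = 0) :
    TendstoUniformly (fun n => rankMap (ν n : Measure (Fin r → ℝ)) (fun z => z i))
      (rankMap (ν' : Measure (Fin r → ℝ)) (fun z => z i)) atTop := by
  have hm : Measurable fun z : Fin r → ℝ => z i := measurable_pi_apply i
  refine tendstoUniformly_of_monotone (fun n => rankMap_mono _ _) (fun n x => rankMap_nonneg _ _ _)
    (fun n x => rankMap_le_one _ _ _) (continuous_rankMap hm h0) (rankMap_mono _ _)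
    (tendsto_rankMap_atBot hm) (tendsto_rankMap_atTop hm) fun x => ?_
  -- The frontier of the half-space lies in the hyperplane `z i = x`, which is null for the limit
  -- law.
  have h := ProbabilityMeasure.tendsto_measure_of_null_frontier_of_tendsto' hν
    (E := {z : Fin r → ℝ | z i ≤ x})
    (measure_mono_null (frontier_le_subset_eq (continuous_apply i) continuous_const) (h0 x))
  exact (ENNReal.tendsto_toReal (measure_ne_top _ _)).comp h

theorem tendstoUniformly_exp_rankMap (hν : Tendsto ν atTop (𝓝 ν')) (i : Fin r)
    (h0 : ∀ x, (ν' : Measure (Fin r → ℝ)) {z | z i = x} = 0) (s : ℝ) :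
    TendstoUniformly
      (fun n (z : Fin r → ℝ) => Complex.exp (Complex.I *
        ((s * rankMap (ν n : Measure (Fin r → ℝ)) (fun z => z i) (z i) : ℝ) : ℂ)))
      (fun z => Complex.exp (Complex.I *
        ((s * rankMap (ν' : Measure (Fin r → ℝ)) (fun z => z i) (z i) : ℝ) : ℂ))) atTop := by
  have hu : UniformContinuous fun x : ℝ => Complex.exp (Complex.I * ((s * x : ℝ) : ℂ)) := by
    refine (LipschitzWith.of_dist_le_mul (K := ‖s‖₊) fun x y => ?_).uniformContinuous
    rw [dist_eq_norm, Real.dist_eq, coe_nnnorm, Real.norm_eq_abs, ← abs_mul, mul_sub]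
    exact norm_exp_I_mul_sub_le _ _
  exact hu.comp_tendstoUniformly ((tendstoUniformly_rankMap hν i h0).comp fun z : Fin r → ℝ => z i)

theorem tendstoUniformly_rankFactor (hν : Tendsto ν atTop (𝓝 ν')) (i : Fin r)
    (h0 : ∀ x, (ν' : Measure (Fin r → ℝ)) {z | z i = x} = 0) (s : ℝ) :
    TendstoUniformly
      (fun n => rankFactor (ν n : Measure (Fin r → ℝ)) (fun z => z i) s)
      (rankFactor (ν' : Measure (Fin r → ℝ)) (fun z => z i) s) atTop := by
  have hu := tendstoUniformly_exp_rankMap hν i h0 s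
  have hm : Measurable fun z : Fin r → ℝ => z i := measurable_pi_apply i
  have hc : Continuous fun z : Fin r → ℝ => Complex.exp (Complex.I *
        ((s * rankMap (ν' : Measure (Fin r → ℝ)) (fun z => z i) (z i) : ℝ) : ℂ)) := by
    have := (continuous_rankMap hm h0).comp (continuous_apply (A := fun _ : Fin r => ℝ) i)
    simp only [Function.comp_def] at this
    fun_prop
  have hφ := tendsto_integral_of_tendstoUniformly hν hc (fun _ => (norm_exp_I_mul _).le)
    (fun n => integrable_exp_rankMap hm s) hu
  exact hφ.tendstoUniformly_const.sub hu

theorem continuous_rankFactor (i : Fin r)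
    (h0 : ∀ x, (ν' : Measure (Fin r → ℝ)) {z | z i = x} = 0) (s : ℝ) :
    Continuous (rankFactor (ν' : Measure (Fin r → ℝ)) (fun z => z i) s) := by
  have := (continuous_rankMap (measurable_pi_apply i) h0).comp
    (continuous_apply (A := fun _ : Fin r => ℝ) i)
  simp only [Function.comp_def] at this
  unfold rankFactor
  fun_prop

theorem tendsto_integral_prod_rankFactor (hν : Tendsto ν atTop (𝓝 ν'))
    (h0 : ∀ i x, (ν' : Measure (Fin r → ℝ)) {z | z i = x} = 0) (S : Finset (Fin r))
    (t : S → ℝ) :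
    Tendsto (fun n => ∫ z, ∏ i : S, rankFactor (ν n : Measure (Fin r → ℝ))
        (fun z => z i) (t i) z ∂(ν n : Measure (Fin r → ℝ))) atTop
      (𝓝 (∫ z, ∏ i : S, rankFactor (ν' : Measure (Fin r → ℝ))
        (fun z => z i) (t i) z ∂(ν' : Measure (Fin r → ℝ)))) := by
  have hle : ∀ (μ : ProbabilityMeasure (Fin r → ℝ)) (i : S) (z : Fin r → ℝ),
      ‖rankFactor (μ : Measure (Fin r → ℝ)) (fun z => z i) (t i) z‖ ≤ 2 := fun μ i z =>
    (norm_rankFactor_le (measurable_pi_apply i.1) _ _).trans (min_le_left _ _)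
  have hprod : ∀ (μ : ProbabilityMeasure (Fin r → ℝ)) (z : Fin r → ℝ),
      ‖∏ i : S, rankFactor (μ : Measure (Fin r → ℝ)) (fun z => z i) (t i) z‖ ≤ ∏ _i : S, 2 :=
    fun μ z => by
      rw [norm_prod]
      exact Finset.prod_le_prod (fun _ _ => norm_nonneg _) fun i _ => hle μ i z
  -- Multiplication is not uniformly continuous on all of `S → ℂ`, but all the factors have norm at
  -- most `2`, so compactness of the polydisc suffices.
  have hK : IsCompact (Set.univ.pi fun _ : S => Metric.closedBall (0 : ℂ) 2) :=
    isCompact_univ_pi fun _ => isCompact_closedBall _ _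
  have hu : UniformContinuousOn (fun w : S → ℂ => ∏ i, w i)
      (Set.univ.pi fun _ : S => Metric.closedBall (0 : ℂ) 2) :=
    hK.uniformContinuousOn_of_continuous (by fun_prop)
  have hpi : TendstoUniformly
      (fun n z (i : S) => rankFactor (ν n : Measure (Fin r → ℝ)) (fun z => z i) (t i) z)
      (fun z (i : S) => rankFactor (ν' : Measure (Fin r → ℝ)) (fun z => z i) (t i) z) atTop := by
    rw [Metric.tendstoUniformly_iff]
    intro ε hε
    have := fun i : S => Metric.tendstoUniformly_iff.1
      (tendstoUniformly_rankFactor hν i.1 (h0 i) (t i)) ε hε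
    filter_upwards [eventually_all.2 this] with n hn z
    exact (dist_pi_lt_iff hε).2 fun i => hn i z
  refine tendsto_integral_of_tendstoUniformly hν
    (continuous_finsetProd _ fun i _ => continuous_rankFactor i.1 (h0 i) (t i)) (hprod ν')
    (fun n => Integrable.of_bound (measurable_prod_rankFactor_apply
      (X := fun z => z) measurable_id' S t).aestronglyMeasurable _ (Eventually.of_forall (hprod (ν n)))) ?_
  exact UniformContinuousOn.comp_tendstoUniformly
    (fun n z => Set.mem_univ_pi.2 fun i => mem_closedBall_zero_iff.2 (hle (ν n) i z))
    (fun z => Set.mem_univ_pi.2 fun i => mem_closedBall_zero_iff.2 (hle ν' i z)) hu hpi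

/-- The rank distance covariance is continuous for weak convergence at every law without atoms in
its marginals. -/
theorem tendsto_rdCovSq (hν : Tendsto ν atTop (𝓝 ν'))
    (h0 : ∀ i x, (ν' : Measure (Fin r → ℝ)) {z | z i = x} = 0) (S : Finset (Fin r)) :
    Tendsto (fun n => rdCovSq (ν n : Measure (Fin r → ℝ)) (fun z => z) S) atTop
      (𝓝 (rdCovSq (ν' : Measure (Fin r → ℝ)) (fun z => z) S)) := by
  simp only [rdCovSq_eq]
  -- The dominating function does not depend on the laws, so convergence for each fixed `t` is
  -- enough.
  refine tendsto_integral_of_dominated_convergence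
    (fun t : S → ℝ => ∏ i : S, ((min 2 |t i|) ^ 2 * weight (t i))) (fun n => ?_)
    (Integrable.fintype_prod fun _ => integrable_min_sq_mul_weight) (fun n => ?_) ?_
  · have h := ((measurable_prod_rankFactor (P := (ν n : Measure (Fin r → ℝ)))
      measurable_id S).stronglyMeasurable.integral_prod_right'
        (ν := (ν n : Measure (Fin r → ℝ)))).measurable
    refine Measurable.aestronglyMeasurable ((h.norm.pow_const 2).mul ?_)
    exact Finset.measurable_fun_prod _ fun i _ => measurable_weight.comp (measurable_pi_apply i)
  · refine Eventually.of_forall fun t => ?_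
    have hw : 0 ≤ ∏ i : S, weight (t i) := Finset.prod_nonneg fun i _ => weight_nonneg _
    rw [Real.norm_of_nonneg (mul_nonneg (sq_nonneg _) hw), Finset.prod_mul_distrib,
      Finset.prod_pow]
    gcongr
    exact norm_integral_prod_rankFactor_le measurable_id S t
  · exact Eventually.of_forall fun t =>
      ((tendsto_integral_prod_rankFactor hν h0 S t).norm.pow 2).mul_const _

/-! ### Empirical measures -/

theorem integral_uniformOn_univ {n : ℕ} {V : Type*} [NormedAddCommGroup V] [NormedSpace ℝ V]
    [CompleteSpace V] (f : Fin (n + 1) → V) :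
    ∫ a, f a ∂(uniformOn Set.univ) = ((n + 1 : ℕ) : ℝ)⁻¹ • ∑ a, f a := by
  rw [uniformOn, ProbabilityTheory.cond, Measure.restrict_univ, integral_smul_measure, integral_countable]
  · simp [Measure.real, ENNReal.toReal_add]
  · exact Integrable.of_finite

instance isProbabilityMeasure_uniformOn_univ {n : ℕ} :
    IsProbabilityMeasure (uniformOn (Set.univ : Set (Fin (n + 1)))) :=
  isProbabilityMeasure_uniformOn Set.finite_univ Set.univ_nonempty

/-- The empirical measure of a nonempty finite family of points. -/
def empiricalMeasure {E : Type*} [MeasurableSpace E] {n : ℕ} (y : Fin (n + 1) → E) :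
    ProbabilityMeasure E :=
  ⟨(uniformOn Set.univ).map y, Measure.isProbabilityMeasure_map Measurable.of_discrete.aemeasurable⟩

theorem measureReal_empiricalMeasure {E : Type*} [MeasurableSpace E] {n : ℕ} (y : Fin (n + 1) → E)
    {s : Set E} (hs : MeasurableSet s) :
    (empiricalMeasure y : Measure E).real s =
      (∑ a, s.indicator (fun _ => (1 : ℝ)) (y a)) / (n + 1 : ℕ) := by
  have h : (empiricalMeasure y : Measure E).real s =
      ∫ a, s.indicator (fun _ => (1 : ℝ)) (y a) ∂(uniformOn Set.univ) := by
    rw [← integral_map (φ := y) (f := s.indicator fun _ => (1 : ℝ))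
      Measurable.of_discrete.aemeasurable
      (measurable_const.indicator hs).aestronglyMeasurable]
    exact (integral_indicator_one hs).symm
  rw [h, integral_uniformOn_univ, smul_eq_mul, inv_mul_eq_div]

variable {Ω : Type*} [MeasurableSpace Ω] {P : Measure Ω} [IsProbabilityMeasure P]

/-- **Varadarajan's theorem**: the empirical measures of an i.i.d. sample converge weakly to the
common law, almost surely. -/
theorem ae_tendsto_empiricalMeasure {E : Type*} [TopologicalSpace E] [SecondCountableTopology E]
    [MeasurableSpace E] [OpensMeasurableSpace E] {X : ℕ → Ω → E} (hindep : iIndepFun X P)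
    {μ : ProbabilityMeasure E} (hX : ∀ k, AEMeasurable (X k) P)
    (hlaw : ∀ k, P.map (X k) = μ) :
    ∀ᵐ ω ∂P, Tendsto (fun n : ℕ => empiricalMeasure fun a : Fin (n + 1) => X a ω) atTop (𝓝 μ) := by
  let B := TopologicalSpace.countableBasis E
  -- Finite intersections of basic open sets form a countable π-system: the strong law is needed for
  -- countably many sets only, and convergence on them forces weak convergence.
  let C : Set (Set E) := (fun T => ⋂₀ T) '' {T | T.Finite ∧ T ⊆ B}
  have hCc : C.Countable :=
    (Set.countable_ofPred_finite_subset (TopologicalSpace.countable_countableBasis E)).image _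
  have hCo : ∀ s ∈ C, IsOpen s := by
    rintro _ ⟨T, ⟨hT, hTB⟩, rfl⟩
    exact hT.isOpen_sInter fun t ht => TopologicalSpace.isOpen_of_mem_countableBasis (hTB ht)
  have hCpi : IsPiSystem C := by
    rintro _ ⟨T, ⟨hT, hTB⟩, rfl⟩ _ ⟨T', ⟨hT', hTB'⟩, rfl⟩ -
    exact ⟨T ∪ T', ⟨hT.union hT', Set.union_subset hTB hTB'⟩, Set.sInter_union _ _⟩
  have hslln : ∀ s ∈ C, ∀ᵐ ω ∂P, Tendsto
      (fun n : ℕ => (∑ k ∈ Finset.range n, s.indicator (fun _ => (1 : ℝ)) (X k ω)) / n) atTop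
      (𝓝 ((μ : Measure E).real s)) := by
    intro s hs
    have hsm := (hCo s hs).measurableSet
    have hφ : Measurable (s.indicator fun _ => (1 : ℝ)) := measurable_const.indicator hsm
    have hident : ∀ k, IdentDistrib (X k) (X 0) P P := fun k =>
      ⟨hX k, hX 0, by rw [hlaw, hlaw]⟩
    have h := strong_law_ae_real (fun k ω => s.indicator (fun _ => (1 : ℝ)) (X k ω))
      (Integrable.of_bound (hφ.comp_aemeasurable (hX 0)).aestronglyMeasurable 1
        (Eventually.of_forall fun ω => by
          by_cases hω : X 0 ω ∈ s <;> simp [hω]))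
      (fun i j hij => (hindep.indepFun hij).comp hφ hφ) (fun k => (hident k).comp hφ)
    have hmean : ∫ ω, s.indicator (fun _ => (1 : ℝ)) (X 0 ω) ∂P = (μ : Measure E).real s := by
      rw [← hlaw 0, ← integral_map (f := s.indicator fun _ => (1 : ℝ)) (hX 0)
        hφ.aestronglyMeasurable]
      exact integral_indicator_one hsm
    rwa [hmean] at h
  filter_upwards [(ae_ball_iff hCc).2 hslln] with ω hω
  refine hCpi.tendsto_probabilityMeasure_of_tendsto_of_mem
    (fun s hs => (hCo s hs).measurableSet) (fun u hu x hx => ?_) (fun s hs => ?_)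
  · obtain ⟨v, hv, hxv, hvu⟩ :=
      (TopologicalSpace.isBasis_countableBasis E).exists_subset_of_mem_open hx hu
    exact ⟨v, ⟨{v}, ⟨Set.finite_singleton v, by simpa using hv⟩, Set.sInter_singleton v⟩,
      (TopologicalSpace.isOpen_of_mem_countableBasis hv).mem_nhds hxv, hvu⟩
  · rw [← NNReal.tendsto_coe]
    have h := (hω s hs).comp (tendsto_add_atTop_nat 1)
    refine h.congr fun n => ?_
    have h' := measureReal_empiricalMeasure (fun a : Fin (n + 1) => X a ω) (hCo s hs).measurableSet
    rw [Fin.sum_univ_eq_sum_range (fun k => s.indicator (fun _ => (1 : ℝ)) (X k ω))] at h'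
    exact h'.symm

/-! ### The empirical objective -/

/-- Pulled back to the uniform law on the index set, expectations become sample averages and the
rank map becomes the empirical one. -/
theorem empRdCovSq_eq {n r : ℕ} (y : Fin (n + 1) → Fin r → ℝ) (S : Finset (Fin r)) :
    empRdCovSq y S = rdCovSq (empiricalMeasure y : Measure (Fin r → ℝ)) (fun z => z) S := by
  have h : rdCovSq (empiricalMeasure y : Measure (Fin r → ℝ)) (fun z => z) S =
      rdCovSq (uniformOn Set.univ) y S := rdCovSq_map Measurable.of_discrete S
  have hrank : ∀ i x, rankMap (uniformOn Set.univ) (fun a => y a i) x = empRankMap y i x := by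
    intro i x
    rw [rankMap, ← integral_indicator_one MeasurableSet.of_discrete, integral_uniformOn_univ,
      empRankMap, smul_eq_mul, Finset.card_filter]
    simp [Set.indicator_apply]
  rw [h]
  unfold rdCovSq empRdCovSq
  simp only [hrank, integral_uniformOn_univ, Complex.real_smul]
  push_cast
  rfl

/-- The rank joint distance covariance of the coordinates under a law on `ℝ^r`. -/
abbrev lawRjdCovSq {r : ℕ} (c : ℝ) (ν : ProbabilityMeasure (Fin r → ℝ)) : ℝ :=
  rjdCovSq (ν : Measure (Fin r → ℝ)) c fun z => z

theorem empRjdCovSq_eq {n r : ℕ} (c : ℝ) (y : Fin (n + 1) → Fin r → ℝ) :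
    empRjdCovSq c y = lawRjdCovSq c (empiricalMeasure y) := by
  simp only [empRjdCovSq, lawRjdCovSq, rjdCovSq, empRdCovSq_eq]

theorem rjdCovSq_map {r : ℕ} (c : ℝ) {X : Ω → Fin r → ℝ} (hX : Measurable X) :
    rjdCovSq (P.map X) c (fun z => z) = rjdCovSq P c X := by
  simp only [rjdCovSq, rdCovSq_map hX]

theorem tendsto_lawRjdCovSq {r : ℕ} (c : ℝ) {ν : ℕ → ProbabilityMeasure (Fin r → ℝ)}
    {ν' : ProbabilityMeasure (Fin r → ℝ)} (hν : Tendsto ν atTop (𝓝 ν'))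
    (h0 : ∀ i x, (ν' : Measure (Fin r → ℝ)) {z | z i = x} = 0) :
    Tendsto (fun n => lawRjdCovSq c (ν n)) atTop (𝓝 (lawRjdCovSq c ν')) :=
  tendsto_finsetSum _ fun _ _ => (tendsto_finsetSum _ fun S _ => tendsto_rdCovSq hν h0 S).const_mul _

/-! ### Rotations -/

theorem continuous_givensMatrix {r : ℕ} (i j : Fin r) : Continuous (givensMatrix i j) := by
  refine continuous_matrix fun a b => ?_
  simp only [givensMatrix, Matrix.of_apply]
  split_ifs <;> fun_prop

theorem continuous_rowRotation {r : ℕ} (i : Fin r) :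
    Continuous fun θ : Angles r => rowRotation θ i := by
  refine continuous_list_prod _ fun j _ => ?_
  by_cases h : i < j
  · simp only [h, dif_pos]
    exact ((continuous_givensMatrix i j).comp (continuous_apply _)).subtype_mk _
  · simp only [h, dif_neg, not_false_eq_true]
    exact continuous_const

theorem continuous_rotation {r : ℕ} : Continuous (rotation : Angles r → SO r) :=
  continuous_list_prod _ fun i _ => continuous_rowRotation i

theorem continuous_rotate_uncurry {r : ℕ} :
    Continuous fun p : Angles r × (Fin r → ℝ) => rotate p.1 p.2 :=
  (continuous_subtype_val.comp (continuous_rotation.comp continuous_fst)).matrix_mulVec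
    continuous_snd

theorem continuous_rotate {r : ℕ} (θ : Angles r) : Continuous (rotate θ) :=
  continuous_const.matrix_mulVec continuous_id

/-- The law of `W(θ) z` when `z` has law `μ`. -/
def rotateLaw {r : ℕ} (θ : Angles r) (μ : ProbabilityMeasure (Fin r → ℝ)) :
    ProbabilityMeasure (Fin r → ℝ) :=
  μ.map (continuous_rotate θ).measurable.aemeasurable

theorem rotateLaw_empiricalMeasure {n r : ℕ} (θ : Angles r) (y : Fin (n + 1) → Fin r → ℝ) :
    rotateLaw θ (empiricalMeasure y) = empiricalMeasure fun a => rotate θ (y a) := by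
  apply Subtype.ext
  exact Measure.map_map (continuous_rotate θ).measurable Measurable.of_discrete

/-- The rotated law is the image of `δ_θ ⊗ μ` under the jointly continuous action, so continuity of
products of laws and the continuous mapping theorem apply. -/
theorem tendsto_rotateLaw {r : ℕ} {θ : ℕ → Angles r} {θ' : Angles r}
    (hθ : Tendsto θ atTop (𝓝 θ')) {μ : ℕ → ProbabilityMeasure (Fin r → ℝ)}
    {μ' : ProbabilityMeasure (Fin r → ℝ)} (hμ : Tendsto μ atTop (𝓝 μ')) :
    Tendsto (fun n => rotateLaw (θ n) (μ n)) atTop (𝓝 (rotateLaw θ' μ')) := by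
  have key : ∀ (η : Angles r) (ν : ProbabilityMeasure (Fin r → ℝ)), rotateLaw η ν =
      ((diracProba η).prod ν).map continuous_rotate_uncurry.measurable.aemeasurable := by
    intro η ν
    apply Subtype.ext
    change (ν : Measure (Fin r → ℝ)).map (rotate η) =
      ((Measure.dirac η).prod (ν : Measure (Fin r → ℝ))).map fun p => rotate p.1 p.2
    rw [Measure.dirac_prod, Measure.map_map continuous_rotate_uncurry.measurable
      measurable_prodMk_left]
    rfl
  simp only [key]
  refine ProbabilityMeasure.tendsto_map_of_tendsto_of_continuous _ _ ?_ continuous_rotate_uncurry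
  exact (ProbabilityMeasure.continuous_prod.tendsto (diracProba θ', μ')).comp
    (((continuous_diracProba.tendsto θ').comp hθ).prodMk_nhds hμ)

/-- A matrix of determinant one preserves Lebesgue measure, so the preimage of a coordinate
hyperplane is null. -/
theorem rotateLaw_hyperplane {r : ℕ} (θ : Angles r) {μ : ProbabilityMeasure (Fin r → ℝ)}
    (hμ : (μ : Measure (Fin r → ℝ)) ≪ volume) (i : Fin r) (x : ℝ) :
    (rotateLaw θ μ : Measure (Fin r → ℝ)) {z | z i = x} = 0 := by
  have hs : MeasurableSet {z : Fin r → ℝ | z i = x} :=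
    measurableSet_eq_fun (measurable_pi_apply i) measurable_const
  have hm := (continuous_rotate θ).measurable
  change (μ : Measure (Fin r → ℝ)).map (rotate θ) {z | z i = x} = 0
  rw [Measure.map_apply hm hs]
  apply hμ
  have hdet : (rotation θ : Matrix (Fin r) (Fin r) ℝ).det = 1 :=
    (Matrix.mem_specialOrthogonalGroup_iff.1 (rotation θ).2).2
  have hvol : (volume : Measure (Fin r → ℝ)).map (rotate θ) = volume := by
    have h := Real.map_matrix_volume_pi_eq_smul_volume_pi
      (M := (rotation θ : Matrix (Fin r) (Fin r) ℝ)) (by rw [hdet]; exact one_ne_zero)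
    rw [hdet] at h
    have hfun : rotate θ = toLin' (rotation θ : Matrix (Fin r) (Fin r) ℝ) := by
      ext z i
      rfl
    simpa [hfun] using h
  rw [← Measure.map_apply hm hs, hvol]
  exact Measure.pi_hyperplane (α := fun _ : Fin r => ℝ) (fun _ => volume) i x

/-! ### Consistency -/

/-- If the empirical laws converge weakly, every sequence of empirical minimizers approaches
the set of population minimizers. -/
theorem tendsto_of_minimizers {r : ℕ} (c : ℝ) {μ : ℕ → ProbabilityMeasure (Fin r → ℝ)}
    {μ' : ProbabilityMeasure (Fin r → ℝ)} (hμ : Tendsto μ atTop (𝓝 μ'))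
    (hac : (μ' : Measure (Fin r → ℝ)) ≪ volume) {Θ : Set (Angles r)} (hΘ : IsCompact Θ)
    {θ : ℕ → Angles r} (hθ : ∀ n, θ n ∈ Θ)
    (hmin : ∀ n, ∀ η ∈ Θ,
      lawRjdCovSq c (rotateLaw (θ n) (μ n)) ≤ lawRjdCovSq c (rotateLaw η (μ n)))
    {f : Angles r → ℝ} (hf : Continuous f) {a : ℝ}
    (hfa : ∀ η ∈ Θ, (∀ ζ ∈ Θ, lawRjdCovSq c (rotateLaw η μ') ≤ lawRjdCovSq c (rotateLaw ζ μ')) →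
      f η = a) :
    Tendsto (fun n => f (θ n)) atTop (𝓝 a) := by
  -- It suffices that each subsequence has a further one along which the claim holds; compactness
  -- supplies a limit `η`, which inherits minimality by passing to the limit in `hmin`.
  refine tendsto_of_subseq_tendsto fun ns hns => ?_
  obtain ⟨η, hη, φ, hφ, hlim⟩ := hΘ.tendsto_subseq fun k => hθ (ns k)
  refine ⟨φ, ?_⟩
  have hμ' : Tendsto (fun k => μ (ns (φ k))) atTop (𝓝 μ') :=
    hμ.comp (hns.comp hφ.tendsto_atTop)
  have hηa : f η = a := by
    refine hfa η hη fun ζ hζ => ?_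
    refine le_of_tendsto_of_tendsto'
      (tendsto_lawRjdCovSq c (tendsto_rotateLaw hlim hμ') (rotateLaw_hyperplane η hac))
      (tendsto_lawRjdCovSq c (tendsto_rotateLaw tendsto_const_nhds hμ')
        (rotateLaw_hyperplane ζ hac)) fun k => ?_
    exact hmin _ ζ hζ
  rw [← hηa]
  exact (hf.tendsto η).comp hlim

end

end RankICA

theorem theorem5p1 {Ω : Type*} [MeasurableSpace Ω] (P : Measure Ω) [IsProbabilityMeasure P]
    {r : ℕ} (hr : 2 ≤ r) (c : ℝ) (hc : 0 ≤ c)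
    -- the whitened vector: centred, with identity covariance matrix and bounded density
    (Z : Ω → Fin r → ℝ) (hZ : Measurable Z)
    (hZ_sq : ∀ i, MemLp (fun ω => Z ω i) 2 P)
    (hZ_mean : ∀ i, ∫ ω, Z ω i ∂P = 0)
    (hZ_cov : ∀ i j, ∫ ω, Z ω i * Z ω j ∂P = if i = j then 1 else 0)
    (hZ_density : ∃ (f : (Fin r → ℝ) → ℝ) (K : ℝ), Measurable f ∧ (∀ z, 0 ≤ f z ∧ f z ≤ K) ∧
      P.map Z = volume.withDensity fun z => ENNReal.ofReal (f z))
    -- the i.i.d. sample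
    (Zs : ℕ → Ω → Fin r → ℝ) (hZs_indep : iIndepFun Zs P)
    (hZs_law : ∀ k, IdentDistrib (Zs k) Z P P)
    -- the compact parameter set, on which the parametrization has a continuous inverse
    (Θ : Set (RankICA.Angles r)) (hΘ_sub : Θ ⊆ RankICA.angleSet r) (hΘ_compact : IsCompact Θ)
    (hΘ_inv : ∃ g : RankICA.SO r → RankICA.Angles r,
      ContinuousOn g (RankICA.rotation '' Θ) ∧ ∀ θ ∈ Θ, g (RankICA.rotation θ) = θ)
    -- the minimizer of the population objective, unique up to signed permutations
    (θ₀ : RankICA.Angles r) (hθ₀_mem : θ₀ ∈ Θ)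
    (hθ₀_min : ∀ θ ∈ Θ, RankICA.rjdCovSq P c (fun ω => RankICA.rotate θ₀ (Z ω)) ≤
      RankICA.rjdCovSq P c (fun ω => RankICA.rotate θ (Z ω)))
    (hθ₀_unique : ∀ θ ∈ Θ, RankICA.rjdCovSq P c (fun ω => RankICA.rotate θ (Z ω)) =
        RankICA.rjdCovSq P c (fun ω => RankICA.rotate θ₀ (Z ω)) →
      RankICA.SignedPermEquiv (RankICA.rotation θ) (RankICA.rotation θ₀))
    -- the estimator: any minimizer of the empirical objective based on the first `n` observations
    (θhat : ℕ → Ω → RankICA.Angles r) (hθhat_mem : ∀ n ω, θhat n ω ∈ Θ)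
    (hθhat_min : ∀ n ω, ∀ θ ∈ Θ,
      RankICA.empRjdCovSq c (fun a : Fin n => RankICA.rotate (θhat n ω) (Zs a ω)) ≤
        RankICA.empRjdCovSq c (fun a : Fin n => RankICA.rotate θ (Zs a ω))) :
    RankICA.IsConsistentOverSO P θhat θ₀ := by
  obtain ⟨f, K, -, -, hdens⟩ := hZ_density
  let μ : ProbabilityMeasure (Fin r → ℝ) :=
    ⟨P.map Z, Measure.isProbabilityMeasure_map hZ.aemeasurable⟩
  have hac : (μ : Measure (Fin r → ℝ)) ≪ volume := by
    change P.map Z ≪ volume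
    rw [hdens]
    exact withDensity_absolutelyContinuous _ _
  have hpop : ∀ θ, RankICA.lawRjdCovSq c (RankICA.rotateLaw θ μ) =
      RankICA.rjdCovSq P c (fun ω => RankICA.rotate θ (Z ω)) := by
    intro θ
    have hm := (RankICA.continuous_rotate θ).measurable
    have h := RankICA.rjdCovSq_map (P := P) c (hm.comp hZ)
    rw [← Measure.map_map hm hZ] at h
    exact h
  refine ⟨RankICA.continuous_rotation, fun D hD => ?_⟩
  filter_upwards [RankICA.ae_tendsto_empiricalMeasure hZs_indep (μ := μ)
    (fun k => (hZs_law k).aemeasurable_fst) (fun k => (hZs_law k).map_eq)] with ω hω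
  -- Sample size zero is dropped, since `empiricalMeasure` needs at least one point.
  rw [← tendsto_add_atTop_iff_nat 1]
  refine RankICA.tendsto_of_minimizers (θ := fun n => θhat (n + 1) ω)
    (f := fun θ => D (RankICA.rotation θ) (RankICA.rotation θ₀)) c hω hac hΘ_compact
    (fun n => hθhat_mem _ ω) (fun n η hη => ?_) ?_ fun η hη hmin => ?_
  · simp only [RankICA.rotateLaw_empiricalMeasure, ← RankICA.empRjdCovSq_eq]
    exact hθhat_min (n + 1) ω η hη
  · exact hD.continuous.comp (RankICA.continuous_rotation.prodMk continuous_const)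
  · refine (hD.eq_zero_iff _ _).2 (hθ₀_unique η hη (le_antisymm ?_ (hθ₀_min η hη)))
    rw [← hpop, ← hpop]
    exact hmin θ₀ hθ₀_mem
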